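/- Let $\mathbf{k}$ be an algebraically closed field of characteristic $\neq 2,3$ and let $\mathrm{Jor}_n\subseteq\mathbf{k}^{n^3}$ be the affine variety of structure constants $(c_{ij}^k)$ of $n$-dimensional Jordan $\mathbf{k}$-algebras, that is, commutative algebras satisfying $((xx)y)x=(xx)(yx)$, on a vector space $V$ with fixed basis $e_1,\dots,e_n$, where $e_ie_j=\sum_k c_{ij}^k e_k$. The group $G=\mathrm{GL}(V)$ acts on $\mathrm{Jor}_n$ by $x\cdot_g y=g(g^{-1}x\cdot g^{-1}y)$; write $\mathcal{J}^G$ for the orbit of $\mathcal{J}$. For $\mathcal{J}_1,\mathcal{J}_2\in\mathrm{Jor}_n$ write $\mathcal{J}_1\to\mathcal{J}_2$ if $\mathcal{J}_2^G$ is contained in the Zariski closure of $\mathcal{J}_1^G$. If $\mathcal{J}_1\to\mathcal{J}_2$, then: 1. if $\mathcal{J}_1\not\simeq\mathcal{J}_2$, then $\dim\mathrm{Aut}(\mathcal{J}_1)<\dim\mathrm{Aut}(\mathcal{J}_2)$, where $\dim$ is the dimension of $\mathrm{Aut}(\mathcal{J})\subseteq\mathrm{GL}_n(\mathbf{k})$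 as an algebraic variety; 2. $\dim\mathrm{Ann}(\mathcal{J}_1)\le\dim\mathrm{Ann}(\mathcal{J}_2)$, where $\mathrm{Ann}(\mathcal{J})=\{a\in\mathcal{J}\mid a\mathcal{J}=0\}$; 3. $\dim\mathcal{J}_1^m\ge\dim\mathcal{J}_2^m$ for every positive integer $m$, where $\mathcal{J}^1=\mathcal{J}$ and $\mathcal{J}^m=\mathcal{J}^{m-1}\mathcal{J}+\mathcal{J}^{m-2}\mathcal{J}^2+\cdots+\mathcal{J}\mathcal{J}^{m-1}$ (products of subspaces being the linear spans of the products of their elements); 4. $\dim Z(\mathcal{J}_1)\le\dim Z(\mathcal{J}_2)$, where $Z(\mathcal{J})=\{a\in\mathcal{J}\mid (a,\mathcal{J},\mathcal{J})=(\mathcal{J},a,\mathcal{J})=(\mathcal{J},\mathcal{J},a)=0\}$ is the associative center and $(x,y,z)=(xy)z-x(yz)$. -/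

import Mathlib

open scoped Topology

namespace JordanDeformation

section Zariski

/-- The common zeros in the affine space `k^σ` of a set `T` of polynomials. -/
def zeros {k : Type*} [Field k] {σ : Type*} (T : Set (MvPolynomial σ k)) : Set (σ → k) :=
  {x | ∀ p ∈ T, MvPolynomial.eval x p = 0}

/-- The Zariski topology on the affine space `k^σ`: the closed sets are the sets of common zeros
of families of polynomials. -/
abbrev zariskiTopology (k : Type*) [Field k] (σ : Type*) : TopologicalSpace (σ → k) :=
  TopologicalSpace.ofClosed {S | ∃ T : Set (MvPolynomial σ k), S = zeros T}
    ⟨{1}, by ext x; simp [zeros]⟩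
    (by
      intro A hA
      have hA' : ∀ S, ∃ T : Set (MvPolynomial σ k), S ∈ A → S = zeros T := fun S => by
        by_cases hS : S ∈ A
        · obtain ⟨T, hT⟩ := hA hS
          exact ⟨T, fun _ => hT⟩
        · exact ⟨∅, fun h => absurd h hS⟩
      choose T hT using hA'
      refine ⟨⋃ S ∈ A, T S, ?_⟩
      ext x
      simp only [Set.mem_sInter, zeros, Set.mem_iUnion, Set.mem_ofPred_eq, exists_prop]
      constructor
      · rintro h p ⟨S, hS, hp⟩
        have hx := h S hS
        rw [hT S hS] at hx
        exact hx p hp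
      · intro h S hS
        rw [hT S hS]
        exact fun p hp => h p ⟨S, hS, hp⟩)
    (by
      rintro _ ⟨T, rfl⟩ _ ⟨U, rfl⟩
      refine ⟨{r | ∃ p ∈ T, ∃ q ∈ U, r = p * q}, ?_⟩
      ext x
      simp only [zeros, Set.mem_union, Set.mem_ofPred_eq]
      constructor
      · rintro (h | h) _ ⟨p, hp, q, hq, rfl⟩
        · simp [h p hp]
        · simp [h q hq]
      · intro h
        by_contra! hc
        obtain ⟨⟨p, hp, hpx⟩, q, hq, hqx⟩ := hc
        have := h _ ⟨p, hp, q, hq, rfl⟩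
        rw [map_mul] at this
        exact (mul_ne_zero hpx hqx) this)

theorem isClosed_zariski_iff {k : Type*} [Field k] {σ : Type*} (S : Set (σ → k)) :
    IsClosed[zariskiTopology k σ] S ↔ ∃ T : Set (MvPolynomial σ k), S = zeros T := by
  rw [← @isOpen_compl_iff _ _ (zariskiTopology k σ)]
  change Sᶜᶜ ∈ {S | ∃ T : Set (MvPolynomial σ k), S = zeros T} ↔ _
  rw [compl_compl]
  rfl

/-- The dimension of a subset of affine space: the Krull dimension (supremum of the lengths of
chains of irreducible closed subsets) of the subset with its induced Zariski topology. -/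
noncomputable def zariskiDim {k : Type*} [Field k] {σ : Type*} (S : Set (σ → k)) : WithBot ℕ∞ :=
  letI : TopologicalSpace (σ → k) := zariskiTopology k σ
  topologicalKrullDim S

end Zariski

section Algebras

/-- Structure constants `c (i, j, l) = c_{ij}^l` of an algebra structure on `k^n` with its standard
basis `e_i`, i.e. `e_i · e_j = ∑ l, c (i, j, l) • e_l`; points of the affine space `k^{n^3}`. -/
abbrev StructConst (k : Type*) (n : ℕ) : Type _ := Fin n × Fin n × Fin n → k

variable {k : Type*} [Field k] {n : ℕ}

/-- The bilinear multiplication on `k^n` with structure constants `c`. -/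
def mul (c : StructConst k n) : (Fin n → k) →ₗ[k] (Fin n → k) →ₗ[k] (Fin n → k) :=
  LinearMap.mk₂ k (fun x y l => ∑ i, ∑ j, x i * y j * c (i, j, l))
    (fun x x' y => by
      ext l; simp only [Pi.add_apply, add_mul, Finset.sum_add_distrib])
    (fun a x y => by
      ext l; simp only [Pi.smul_apply, smul_eq_mul, Finset.mul_sum, mul_assoc])
    (fun x y y' => by
      ext l; simp only [Pi.add_apply, mul_add, add_mul, Finset.sum_add_distrib])
    (fun a x y => by
      ext l; simp only [Pi.smul_apply, smul_eq_mul, Finset.mul_sum, mul_assoc, mul_left_comm])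

theorem mul_single_single (c : StructConst k n) (i j l : Fin n) :
    mul c (Pi.single i 1) (Pi.single j 1) l = c (i, j, l) := by
  simp [mul, LinearMap.mk₂_apply, Pi.single_apply]

/-- `Jor_n`: the structure constants of Jordan algebras, i.e. of commutative algebras satisfying
the Jordan identity `((x x) y) x = (x x) (y x)`. -/
def Jor (k : Type*) [Field k] (n : ℕ) : Set (StructConst k n) :=
  {c | (∀ x y, mul c x y = mul c y x) ∧
    ∀ x y, mul c (mul c (mul c x x) y) x = mul c (mul c x x) (mul c y x)}

/-- The change of basis action of `GL_n(k)` on structure constants: `act g c` are the structure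
constants of the multiplication `x ·_g y = g (g⁻¹ x · g⁻¹ y)`, see `mul_act`. -/
def act (g : GL (Fin n) k) (c : StructConst k n) : StructConst k n :=
  fun p => (g.1.mulVec (mul c (g⁻¹.1.mulVec (Pi.single p.1 1))
    (g⁻¹.1.mulVec (Pi.single p.2.1 1)))) p.2.2

theorem mul_act (g : GL (Fin n) k) (c : StructConst k n) (x y : Fin n → k) :
    mul (act g c) x y = g.1.mulVec (mul c (g⁻¹.1.mulVec x) (g⁻¹.1.mulVec y)) := by
  have h : mul (act g c) =
      ((mul c).compl₁₂ (Matrix.mulVecLin g⁻¹.1) (Matrix.mulVecLin g⁻¹.1)).compr₂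
        (Matrix.mulVecLin g.1) := by
    refine LinearMap.ext_basis (Pi.basisFun k (Fin n)) (Pi.basisFun k (Fin n)) fun i j => ?_
    ext l
    rw [Pi.basisFun_apply, Pi.basisFun_apply, mul_single_single]
    rfl
  rw [h]
  rfl

/-- The orbit of an algebra under change of basis. -/
def orbit (c : StructConst k n) : Set (StructConst k n) :=
  Set.range fun g : GL (Fin n) k => act g c

/-- `Deforms c₁ c₂` is `c₁ → c₂`: the orbit of `c₂` is contained in the Zariski closure of the
orbit of `c₁`. -/
def Deforms (c₁ c₂ : StructConst k n) : Prop :=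
  orbit c₂ ⊆ closure[zariskiTopology k (Fin n × Fin n × Fin n)] (orbit c₁)

/-- Isomorphism of algebras. -/
def Isomorphic (c₁ c₂ : StructConst k n) : Prop :=
  ∃ f : (Fin n → k) ≃ₗ[k] (Fin n → k), ∀ x y, f (mul c₁ x y) = mul c₂ (f x) (f y)

/-- The automorphism group of an algebra, as a set of matrices in the affine space `k^{n^2}`. -/
def autSet (c : StructConst k n) : Set (Fin n × Fin n → k) :=
  {a | ∃ g : GL (Fin n) k,
    (∀ x y, g.1.mulVec (mul c x y) = mul c (g.1.mulVec x) (g.1.mulVec y)) ∧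
    a = fun p => g.1 p.1 p.2}

/-- The dimension of the automorphism group as an algebraic group. -/
noncomputable def dimAut (c : StructConst k n) : WithBot ℕ∞ := zariskiDim (autSet c)

/-- The annihilator `{a | a J = 0}`. -/
def ann (c : StructConst k n) : Submodule k (Fin n → k) where
  carrier := {a | ∀ x, mul c a x = 0}
  add_mem' := fun ha hb x => by simp [ha x, hb x]
  zero_mem' := fun x => by simp
  smul_mem' := fun r a ha x => by simp [ha x]

/-- The powers of an algebra: `J^1 = J` and `J^m = J^{m-1} J + J^{m-2} J^2 + ⋯ + J J^{m-1}`,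
where the product of two subspaces is the span of the products. (The value at `0` is not used.) -/
def power (c : StructConst k n) : ℕ → Submodule k (Fin n → k)
  | 0 => ⊤
  | 1 => ⊤
  | m + 2 => ⨆ i : Fin (m + 1), Submodule.map₂ (mul c) (power c (m + 1 - i)) (power c (i + 1))

/-- The associator `(x, y, z) = (x y) z - x (y z)`. -/
def assoc (c : StructConst k n) (x y z : Fin n → k) : Fin n → k :=
  mul c (mul c x y) z - mul c x (mul c y z)

/-- The associative center `{a | (a, J, J) = (J, a, J) = (J, J, a) = 0}`. -/
def assocCenter (c : StructConst k n) : Submodule k (Fin n → k) where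
  carrier := {a | ∀ x y, assoc c a x y = 0 ∧ assoc c x a y = 0 ∧ assoc c x y a = 0}
  add_mem' := by
    intro a b ha hb x y
    simp only [assoc, Set.mem_ofPred_eq, sub_eq_zero] at ha hb ⊢
    simp [ha x y, hb x y]
  zero_mem' := fun x y => by simp [assoc]
  smul_mem' := by
    intro r a ha x y
    simp only [assoc, Set.mem_ofPred_eq, sub_eq_zero] at ha ⊢
    simp [ha x y]

end Algebras

end JordanDeformation

/-! Items 2–4 are rank semicontinuity. A nonvanishing minor is an open condition, so a rank
depending polynomially on the structure constants that is at least `d` at `J₂` is at least `d`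
somewhere on the orbit of `J₁`. The annihilator and the associative center are kernels of matrices
polynomial in the constants, the powers are spans of polynomial vectors, and their dimensions are
constant on orbits.

Item 1 rests on the orbit map from GL_n to the orbit closure. Dually, the coordinate ring `orbitRing
c` of the closure is a subring of `CoordGL`. Generic Noether normalization yields a nonzero `f` such
that every fiber over a point with `f ≠ 0` has dimension exactly `r`, where `r` is the drop in
transcendence degree. A nonempty fiber is a coset of the automorphism group, so `dimAut c = r`; and
since the fibers over `f ≠ 0` are nonempty, those points lie in the orbit (`exists_dimAut_eq`).

A degeneration gives a surjection of orbit rings. Were it injective, `f` would be nonzero at some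
point of the orbit of `J₂`, which would then lie in the orbit of `J₁`. For non-isomorphic algebras
it therefore has a kernel, the transcendence degree drops (`trdeg_lt_trdeg_of_surjective`), and the
complementary dimension of the automorphism group grows. -/

namespace JordanDeformation

/-! ### Semicontinuity of ranks: annihilator, associative center and powers -/

section Semicontinuity

variable {k : Type*} [Field k] {n : ℕ}

/-- A set contained in the Zariski closure of `S` satisfies the equations of `S`. -/
theorem eval_eq_zero_of_mem_closure {σ : Type*} {S : Set (σ → k)} {x : σ → k}
    (hx : x ∈ closure[zariskiTopology k σ] S) (Q : MvPolynomial σ k)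
    (hQ : ∀ y ∈ S, MvPolynomial.eval y Q = 0) : MvPolynomial.eval x Q = 0 := by
  let := zariskiTopology k σ
  have hcl : IsClosed (zeros {Q}) := (isClosed_zariski_iff _).2 ⟨{Q}, rfl⟩
  have hS : S ⊆ zeros {Q} := by
    rintro y hy p rfl
    exact hQ y hy
  exact closure_minimal hS hcl hx Q rfl

theorem mul_apply (c : StructConst k n) (x y : Fin n → k) (l : Fin n) :
    mul c x y l = ∑ i, ∑ j, x i * y j * c (i, j, l) := rfl

theorem act_one (c : StructConst k n) : act 1 c = c := by
  ext ⟨i, j, l⟩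
  rw [← mul_single_single (act 1 c), mul_act, ← mul_single_single c, inv_one, Units.val_one,
    Matrix.one_mulVec, Matrix.one_mulVec, Matrix.one_mulVec]

theorem act_mul (g h : GL (Fin n) k) (c : StructConst k n) : act (g * h) c = act g (act h c) := by
  ext ⟨i, j, l⟩
  rw [← mul_single_single (act (g * h) c), ← mul_single_single (act g (act h c)),
    mul_act, mul_act, mul_act, mul_inv_rev, Units.val_mul, Units.val_mul]
  simp only [← Matrix.mulVec_mulVec]

theorem mem_orbit_self (c : StructConst k n) : c ∈ orbit c := ⟨1, act_one c⟩

/-- The linear automorphism of `k^n` given by an invertible matrix. -/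
noncomputable def glEquiv (g : GL (Fin n) k) : (Fin n → k) ≃ₗ[k] (Fin n → k) :=
  LinearEquiv.ofLinearMap (Matrix.mulVecLin g.1) (Matrix.mulVecLin g⁻¹.1)
    (by ext1; simp [← Matrix.mulVecLin_mul]) (by ext1; simp [← Matrix.mulVecLin_mul])

theorem glEquiv_apply (g : GL (Fin n) k) (x : Fin n → k) : glEquiv g x = g.1.mulVec x := rfl

theorem mul_act_glEquiv (g : GL (Fin n) k) (c : StructConst k n) (x y : Fin n → k) :
    mul (act g c) (glEquiv g x) (glEquiv g y) = glEquiv g (mul c x y) := by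
  simp [mul_act, glEquiv_apply, Matrix.mulVec_mulVec]

theorem assoc_act_glEquiv (g : GL (Fin n) k) (c : StructConst k n) (x y z : Fin n → k) :
    assoc (act g c) (glEquiv g x) (glEquiv g y) (glEquiv g z) = glEquiv g (assoc c x y z) := by
  simp only [assoc, mul_act_glEquiv, map_sub]

theorem ann_act (g : GL (Fin n) k) (c : StructConst k n) :
    ann (act g c) = (ann c).map (glEquiv g).toLinearMap := by
  ext a
  obtain ⟨a, rfl⟩ := (glEquiv g).surjective a
  rw [Submodule.mem_map_equiv, LinearEquiv.symm_apply_apply]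
  change (∀ x, _) ↔ ∀ x, _
  rw [(glEquiv g).surjective.forall]
  simp only [mul_act_glEquiv, EmbeddingLike.map_eq_zero_iff]

theorem assocCenter_act (g : GL (Fin n) k) (c : StructConst k n) :
    assocCenter (act g c) = (assocCenter c).map (glEquiv g).toLinearMap := by
  ext a
  obtain ⟨a, rfl⟩ := (glEquiv g).surjective a
  rw [Submodule.mem_map_equiv, LinearEquiv.symm_apply_apply]
  change (∀ x y, _) ↔ ∀ x y, _
  rw [(glEquiv g).surjective.forall]
  refine forall_congr' fun x => ?_
  rw [(glEquiv g).surjective.forall]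
  simp only [assoc_act_glEquiv, EmbeddingLike.map_eq_zero_iff]

theorem power_act (g : GL (Fin n) k) (c : StructConst k n) (m : ℕ) :
    power (act g c) m = (power c m).map (glEquiv g).toLinearMap := by
  induction m using power.induct with
  | case1 => simp [power]
  | case2 => simp [power]
  | case3 m ih₁ ih₂ =>
    simp only [power, Submodule.map_iSup]
    refine iSup_congr fun i => ?_
    rw [ih₁ i, ih₂ i, Submodule.map_map₂, Submodule.map₂_map_map]
    congr 1
    exact LinearMap.ext₂ fun x y => mul_act_glEquiv g c x y

theorem finrank_map_glEquiv (g : GL (Fin n) k) (S : Submodule k (Fin n → k)) :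
    Module.finrank k (S.map (glEquiv g).toLinearMap) = Module.finrank k S :=
  ((glEquiv g).submoduleMap S).finrank_eq.symm

/-- Polynomial functions of the structure constants. -/
def IsPolynomial (F : StructConst k n → k) : Prop :=
  ∃ Q : MvPolynomial (Fin n × Fin n × Fin n) k, ∀ c, F c = MvPolynomial.eval c Q

namespace IsPolynomial

theorem const (a : k) : IsPolynomial (fun _ : StructConst k n => a) :=
  ⟨MvPolynomial.C a, by simp⟩

theorem coord (p : Fin n × Fin n × Fin n) : IsPolynomial (fun c : StructConst k n => c p) :=
  ⟨MvPolynomial.X p, by simp⟩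

theorem mul {F G : StructConst k n → k} (hF : IsPolynomial F) (hG : IsPolynomial G) :
    IsPolynomial (fun c => F c * G c) := by
  obtain ⟨P, hP⟩ := hF
  obtain ⟨Q, hQ⟩ := hG
  exact ⟨P * Q, fun c => by simp [hP, hQ]⟩

theorem sub {F G : StructConst k n → k} (hF : IsPolynomial F) (hG : IsPolynomial G) :
    IsPolynomial (fun c => F c - G c) := by
  obtain ⟨P, hP⟩ := hF
  obtain ⟨Q, hQ⟩ := hG
  exact ⟨P - Q, fun c => by simp [hP, hQ]⟩

theorem sum {ι : Type*} [Fintype ι] {F : ι → StructConst k n → k}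
    (hF : ∀ i, IsPolynomial (F i)) : IsPolynomial (fun c => ∑ i, F i c) := by
  choose P hP using hF
  exact ⟨∑ i, P i, fun c => by simp [hP]⟩

theorem structMul {x y : StructConst k n → Fin n → k} (hx : ∀ l, IsPolynomial fun c => x c l)
    (hy : ∀ l, IsPolynomial fun c => y c l) (l : Fin n) :
    IsPolynomial fun c => JordanDeformation.mul c (x c) (y c) l :=
  sum fun i => sum fun j => ((hx i).mul (hy j)).mul (coord _)

theorem structAssoc {x y z : StructConst k n → Fin n → k} (hx : ∀ l, IsPolynomial fun c => x c l)
    (hy : ∀ l, IsPolynomial fun c => y c l) (hz : ∀ l, IsPolynomial fun c => z c l) (l : Fin n) :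
    IsPolynomial fun c => assoc c (x c) (y c) (z c) l :=
  (structMul (structMul hx hy) hz l).sub (structMul hx (structMul hy hz) l)

end IsPolynomial

/-- The dimension of the span of a polynomial family of vectors is lower semicontinuous. -/
theorem Deforms.exists_act_finrank_span_le {c₁ c₂ : StructConst k n} (h : Deforms c₁ c₂)
    {ι τ : Type*} [Fintype τ] (v : ι → StructConst k n → τ → k)
    (hv : ∀ i t, IsPolynomial fun c => v i c t) :
    ∃ g : GL (Fin n) k, Module.finrank k (Submodule.span k (Set.range fun i => v i c₂)) ≤
      Module.finrank k (Submodule.span k (Set.range fun i => v i (act g c₁))) := by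
  classical
  obtain ⟨κ, a, -, ha, hli⟩ := exists_linearIndependent' k (fun i => v i c₂)
  have : Finite κ := LinearIndependent.finite hli
  have : Fintype κ := Fintype.ofFinite κ
  have hdim : Module.finrank k (Submodule.span k (Set.range fun i => v i c₂)) =
      Fintype.card κ := by
    rw [← ha]
    exact finrank_span_eq_card hli
  -- `L` reads off coordinates in the basis chosen at `c₂`. It replaces the choice of a minor: the
  -- matrix `M` of these coordinates is square, polynomial in `c`, and the identity at `c₂`.
  obtain ⟨L, hL⟩ := LinearMap.exists_leftInverse_of_injective
    (Fintype.linearCombination k ((fun i => v i c₂) ∘ a))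
    (LinearMap.ker_eq_bot.2 (linearIndependent_iff_injective_fintypeLinearCombination.1 hli))
  have hLe : ∀ j, L (v (a j) c₂) = Pi.single j 1 := fun j => by
    have := LinearMap.congr_fun hL (Pi.single j 1)
    simpa [Fintype.linearCombination_apply_single] using this
  choose P hP using hv
  let M : Matrix κ κ (MvPolynomial (Fin n × Fin n × Fin n) k) :=
    Matrix.of fun i j => ∑ t, P (a j) t * MvPolynomial.C (L (Pi.single t 1) i)
  have hM : ∀ c i j, MvPolynomial.eval c (M i j) = L (v (a j) c) i := fun c i j => by
    conv_rhs => rw [pi_eq_sum_univ' (v (a j) c)]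
    simp [M, hP, Finset.sum_apply, map_sum]
  have hdet : ∃ g : GL (Fin n) k, MvPolynomial.eval (act g c₁) M.det ≠ 0 := by
    by_contra! hcon
    have h0 := eval_eq_zero_of_mem_closure (h (mem_orbit_self c₂)) M.det
      (by rintro _ ⟨g, rfl⟩; exact hcon g)
    have h1 : (MvPolynomial.eval c₂).mapMatrix M = 1 := by
      ext i j
      rw [RingHom.mapMatrix_apply, Matrix.map_apply, hM, hLe, Matrix.one_apply, Pi.single_apply]
    rw [RingHom.map_det, h1, Matrix.det_one] at h0
    exact one_ne_zero h0
  obtain ⟨g, hg⟩ := hdet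
  refine ⟨g, ?_⟩
  have hg' : LinearIndependent k fun j => L (v (a j) (act g c₁)) := by
    rw [RingHom.map_det] at hg
    have hcol : ((MvPolynomial.eval (act g c₁)).mapMatrix M).col =
        fun j => L (v (a j) (act g c₁)) := by
      ext j i
      rw [Matrix.col_apply, RingHom.mapMatrix_apply, Matrix.map_apply, hM]
    exact hcol ▸ Matrix.linearIndependent_cols_of_det_ne_zero hg
  have hg'' : LinearIndependent k fun j => v (a j) (act g c₁) := LinearIndependent.of_comp L hg'
  rw [hdim, ← finrank_span_eq_card hg'']
  refine Submodule.finrank_mono (Submodule.span_mono ?_)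
  rintro _ ⟨j, rfl⟩
  exact ⟨a j, rfl⟩

/-- The dimension of the kernel of a polynomial family of linear maps is upper semicontinuous. -/
theorem Deforms.exists_act_finrank_ker_le {c₁ c₂ : StructConst k n} (h : Deforms c₁ c₂)
    {τ : Type*} [Fintype τ] (f : StructConst k n → (Fin n → k) →ₗ[k] (τ → k))
    (hf : ∀ i t, IsPolynomial fun c => f c (Pi.single i 1) t) :
    ∃ g : GL (Fin n) k, Module.finrank k (LinearMap.ker (f (act g c₁))) ≤
      Module.finrank k (LinearMap.ker (f c₂)) := by
  obtain ⟨g, hg⟩ := h.exists_act_finrank_span_le (fun i c => f c (Pi.single i 1)) hf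
  have hr : ∀ c, Submodule.span k (Set.range fun i => f c (Pi.single i 1)) =
      LinearMap.range (f c) := fun c => by
    rw [LinearMap.range_eq_map, ← (Pi.basisFun k (Fin n)).span_eq, Submodule.map_span,
      ← Set.range_comp]
    congr 2
    ext i
    simp
  rw [hr, hr] at hg
  refine ⟨g, ?_⟩
  have h₁ := (f (act g c₁)).finrank_range_add_finrank_ker
  have h₂ := (f c₂).finrank_range_add_finrank_ker
  omega

/-- The annihilator is the kernel of `a ↦ (a e_i)_i`, whose matrix entries are the structure
constants themselves. -/
theorem Deforms.finrank_ann_le {c₁ c₂ : StructConst k n} (h : Deforms c₁ c₂) :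
    Module.finrank k (ann c₁) ≤ Module.finrank k (ann c₂) := by
  let f : StructConst k n → (Fin n → k) →ₗ[k] (Fin n × Fin n → k) := fun c =>
    LinearMap.pi fun p => LinearMap.proj p.2 ∘ₗ (mul c).flip (Pi.single p.1 1)
  have hf : ∀ c, LinearMap.ker (f c) = ann c := fun c => by
    ext a
    rw [LinearMap.mem_ker]
    change _ ↔ ∀ x, mul c a x = 0
    constructor
    · intro ha
      have : mul c a = 0 := (Pi.basisFun k (Fin n)).ext fun i => by
        ext l
        simpa [f] using congr_fun ha (i, l)
      simp [this]
    · intro ha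
      ext p
      simp [f, ha]
  obtain ⟨g, hg⟩ := h.exists_act_finrank_ker_le f fun i p =>
    IsPolynomial.structMul (x := fun _ => Pi.single i 1) (y := fun _ => Pi.single p.1 1)
      (fun _ => .const _) (fun _ => .const _) _
  rwa [hf, hf, ann_act, finrank_map_glEquiv] at hg

theorem assoc_eq_zero_of_basis {c : StructConst k n} (a : Fin n → k)
    (h : ∀ i j, assoc c a (Pi.single i 1) (Pi.single j 1) = 0 ∧
      assoc c (Pi.single i 1) a (Pi.single j 1) = 0 ∧
      assoc c (Pi.single i 1) (Pi.single j 1) a = 0) : a ∈ assocCenter c := by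
  intro x y
  rw [pi_eq_sum_univ' x, pi_eq_sum_univ' y]
  simp only [assoc, sub_eq_zero] at h ⊢
  simp only [map_sum, map_smul, LinearMap.sum_apply, LinearMap.smul_apply, h, and_self]

/-- By trilinearity the center is cut out by associators with basis vectors in the other two slots,
a linear system in `a` with coefficients quadratic in the structure constants. -/
theorem Deforms.finrank_assocCenter_le {c₁ c₂ : StructConst k n} (h : Deforms c₁ c₂) :
    Module.finrank k (assocCenter c₁) ≤ Module.finrank k (assocCenter c₂) := by
  let e : Fin n → Fin n → k := fun i => Pi.single i 1
  let T := Fin n × Fin n × Fin n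
  let f : StructConst k n → (Fin n → k) →ₗ[k] (T ⊕ T ⊕ T → k) := fun c =>
    { toFun := fun a => Sum.elim (fun p => assoc c a (e p.1) (e p.2.1) p.2.2)
        (Sum.elim (fun p => assoc c (e p.1) a (e p.2.1) p.2.2)
          (fun p => assoc c (e p.1) (e p.2.1) a p.2.2))
      map_add' := fun a b => by
        ext (p | p | p) <;> simp [assoc, add_sub_add_comm]
      map_smul' := fun r a => by
        ext (p | p | p) <;> simp [assoc, mul_sub] }
  have hf : ∀ c, LinearMap.ker (f c) = assocCenter c := fun c => by
    ext a
    rw [LinearMap.mem_ker]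
    constructor
    · refine fun ha => assoc_eq_zero_of_basis a fun i j => ⟨?_, ?_, ?_⟩ <;> ext l
      · exact congr_fun ha (.inl (i, j, l))
      · exact congr_fun ha (.inr (.inl (i, j, l)))
      · exact congr_fun ha (.inr (.inr (i, j, l)))
    · intro ha
      ext (⟨i, j, l⟩ | ⟨i, j, l⟩ | ⟨i, j, l⟩)
      · exact congr_fun (ha (e i) (e j)).1 l
      · exact congr_fun (ha (e i) (e j)).2.1 l
      · exact congr_fun (ha (e i) (e j)).2.2 l
  obtain ⟨g, hg⟩ := h.exists_act_finrank_ker_le f (by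
    rintro i (⟨p, q, l⟩ | ⟨p, q, l⟩ | ⟨p, q, l⟩)
    · exact IsPolynomial.structAssoc (x := fun _ => e i) (y := fun _ => e p) (z := fun _ => e q)
        (fun _ => .const _) (fun _ => .const _) (fun _ => .const _) l
    · exact IsPolynomial.structAssoc (x := fun _ => e p) (y := fun _ => e i) (z := fun _ => e q)
        (fun _ => .const _) (fun _ => .const _) (fun _ => .const _) l
    · exact IsPolynomial.structAssoc (x := fun _ => e p) (y := fun _ => e q) (z := fun _ => e i)
        (fun _ => .const _) (fun _ => .const _) (fun _ => .const _) l)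
  rwa [hf, hf, assocCenter_act, finrank_map_glEquiv] at hg

/-- The powers of an algebra are spanned by vectors depending polynomially on its structure
constants. -/
theorem exists_isPolynomial_span_eq_power (m : ℕ) :
    ∃ (ι : Type) (v : ι → StructConst k n → Fin n → k),
      (∀ i l, IsPolynomial fun c => v i c l) ∧
      ∀ c, power c m = Submodule.span k (Set.range fun i => v i c) := by
  have top : ∃ (ι : Type) (v : ι → StructConst k n → Fin n → k),
      (∀ i l, IsPolynomial fun c => v i c l) ∧
      ∀ c, ⊤ = Submodule.span k (Set.range fun i => v i c) :=
    ⟨Fin n, fun i _ => Pi.single i 1, fun _ _ => .const _, fun _ => by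
      rw [← (Pi.basisFun k (Fin n)).span_eq]
      congr 2
      ext i
      simp⟩
  induction m using power.induct with
  | case1 => simpa only [power] using top
  | case2 => simpa only [power] using top
  | case3 m ih₁ ih₂ =>
    choose ι₁ v₁ hv₁ hs₁ using ih₁
    choose ι₂ v₂ hv₂ hs₂ using ih₂
    refine ⟨Σ i, ι₁ i × ι₂ i, fun s c => mul c (v₁ s.1 s.2.1 c) (v₂ s.1 s.2.2 c),
      fun s => IsPolynomial.structMul (hv₁ _ _) (hv₂ _ _), fun c => ?_⟩
    simp only [power, hs₁, hs₂, Submodule.map₂_span_span, ← Submodule.span_iUnion]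
    congr 1
    ext x
    simp [Set.mem_image2]

theorem Deforms.finrank_power_le {c₁ c₂ : StructConst k n} (h : Deforms c₁ c₂) (m : ℕ) :
    Module.finrank k (power c₂ m) ≤ Module.finrank k (power c₁ m) := by
  obtain ⟨ι, v, hv, hs⟩ := exists_isPolynomial_span_eq_power (k := k) (n := n) m
  obtain ⟨g, hg⟩ := h.exists_act_finrank_span_le v hv
  rwa [← hs, ← hs, power_act, finrank_map_glEquiv] at hg

end Semicontinuity

/-! ### Krull dimension, transcendence degree and generic Noether normalization -/

section CommutativeAlgebra

open MvPolynomial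

/-- An injective integral extension preserves the Krull dimension. -/
theorem ringKrullDim_eq_of_isIntegral_of_injective {R S : Type*} [CommRing R] [CommRing S]
    [Algebra R S] [Algebra.IsIntegral R S]
    (h : Function.Injective (algebraMap R S)) : ringKrullDim R = ringKrullDim S := by
  apply le_antisymm
  · refine iSup_le fun l => ?_
    -- Lying over for the bottom of the chain, then going up for the rest; the reverse inequality is
    -- incomparability.
    obtain ⟨Q, -, hQ, hQl⟩ := Ideal.exists_ideal_over_prime_of_isIntegral l.head.asIdeal
      (⊥ : Ideal S) (by
        rw [← RingHom.ker_eq_comap_bot, (RingHom.injective_iff_ker_eq_bot _).1 h]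
        exact bot_le)
    have : Q.LiesOver l.head.asIdeal := ⟨hQl.symm⟩
    obtain ⟨L, hL, -⟩ := Ideal.exists_ltSeries_of_hasGoingUp l Q
    rw [← hL]
    exact Order.LTSeries.length_le_krullDim L
  · refine Order.krullDim_le_of_strictMono (PrimeSpectrum.comap (algebraMap R S))
      fun P Q hPQ => ?_
    exact Ideal.IsIntegral.comap_lt_comap (I := P.asIdeal) (J := Q.asIdeal) hPQ

/-- A surjection of domains which is not injective strictly lowers the transcendence degree. -/
theorem trdeg_lt_trdeg_of_surjective {k A B : Type*} [Field k] [CommRing A] [IsDomain A]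
    [Algebra k A] [Algebra.FiniteType k A] [CommRing B] [IsDomain B] [Algebra k B]
    (φ : A →ₐ[k] B) (hφ : Function.Surjective φ) (hinj : ¬ Function.Injective φ) :
    (Algebra.trdeg k B).toNat < (Algebra.trdeg k A).toNat := by
  have hA := trdeg_lt_aleph0_of_finiteType (R := k) (S := A)
  have : Algebra.FiniteType k B := .of_surjective φ hφ
  have hB := trdeg_lt_aleph0_of_finiteType (R := k) (S := B)
  obtain ⟨s, hs⟩ := exists_isTranscendenceBasis k B
  have hcard := hs.cardinalMk_eq_trdeg
  have : Finite s := Cardinal.mk_lt_aleph0_iff.1 (hcard ▸ hB)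
  choose x hx using fun b : s => hφ b
  have hφx : φ ∘ x = ((↑) : s → B) := funext hx
  have hxind : AlgebraicIndependent k x := .of_comp φ (hφx ▸ hs.1)
  by_contra! hle
  -- If the degree did not drop, lifts of a transcendence basis of `B` would be one of `A`. A
  -- nonzero `a` in the kernel then divides a nonzero polynomial in the lifts, which `φ` kills,
  -- although `φ` is injective on such polynomials.
  have hxb : IsTranscendenceBasis k x := by
    refine hxind.isTranscendenceBasis_of_lift_trdeg_le_of_finite ?_
    rw [hcard, ← Cardinal.toNat_le_iff_le_of_lt_aleph0 (by simpa using hA) (by simpa using hB)]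
    simpa using hle
  have := hxb.isAlgebraic
  rw [injective_iff_map_eq_zero] at hinj
  push Not at hinj
  obtain ⟨a, ha, ha0⟩ := hinj
  obtain ⟨⟨r, hr⟩, hr0, hdvd⟩ := (Algebra.IsAlgebraic.isAlgebraic
    (R := Algebra.adjoin k (Set.range x)) a).exists_nonzero_dvd (mem_nonZeroDivisors_of_ne_zero ha0)
  rw [Algebra.adjoin_range_eq_range_aeval] at hr
  obtain ⟨P, rfl⟩ := hr
  have h0 : aeval (φ ∘ x) P = 0 := by
    rw [← zero_dvd_iff, ← ha]
    have := map_dvd φ hdvd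
    rwa [show φ (algebraMap _ A _) = aeval (φ ∘ x) P from DFunLike.congr_fun (comp_aeval x φ) P]
      at this
  rw [hφx] at h0
  have hP := hs.1.eq_zero_of_aeval_eq_zero P h0
  exact hr0 (Subtype.ext (by simp [hP]))

/-- An element of the adjoined algebra involves only finitely many coefficients in `K`, so their
denominators can be cleared at once. -/
theorem exists_denominator {A R K L : Type*} [CommRing A] [IsDomain A] [CommRing R] [Algebra A R]
    [Field K] [Algebra A K] [IsFractionRing A K] [Field L] [Algebra R L] [Algebra A L]
    [Algebra K L] [IsScalarTower A K L] [IsScalarTower A R L] {s : Set R} {z : L}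
    (hz : z ∈ Algebra.adjoin K (algebraMap R L '' s)) :
    ∃ a : A, a ≠ 0 ∧ ∃ w : R, algebraMap R L w = algebraMap A L a * z := by
  induction hz using Algebra.adjoin_induction with
  | mem z hz =>
    obtain ⟨w, -, rfl⟩ := hz
    exact ⟨1, one_ne_zero, w, by simp⟩
  | algebraMap q =>
    obtain ⟨a, b, hb, rfl⟩ := IsFractionRing.div_surjective (A := A) q
    have hb0 := nonZeroDivisors.ne_zero hb
    have hbK : algebraMap A K b ≠ 0 := by simpa using hb0
    refine ⟨b, hb0, algebraMap A R a, ?_⟩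
    rw [← IsScalarTower.algebraMap_apply, IsScalarTower.algebraMap_apply A K L,
      IsScalarTower.algebraMap_apply A K L, ← map_mul, mul_div_cancel₀ _ hbK]
  | add z z' _ _ h h' =>
    obtain ⟨a, ha, w, hw⟩ := h
    obtain ⟨a', ha', w', hw'⟩ := h'
    refine ⟨a * a', mul_ne_zero ha ha', algebraMap A R a' * w + algebraMap A R a * w', ?_⟩
    simp only [map_add, map_mul, hw, hw', ← IsScalarTower.algebraMap_apply]
    ring
  | mul z z' _ _ h h' =>
    obtain ⟨a, ha, w, hw⟩ := h
    obtain ⟨a', ha', w', hw'⟩ := h'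
    refine ⟨a * a', mul_ne_zero ha ha', w * w', ?_⟩
    simp only [map_mul, hw, hw']
    ring

theorem isIntegralElem_comp_iff_of_injective {R S T : Type*} [CommRing R] [CommRing S]
    [CommRing T] (f : R →+* S) (g : S →+* T) (hg : Function.Injective g) (x : S) :
    (g.comp f).IsIntegralElem (g x) ↔ f.IsIntegralElem x := by
  simp only [RingHom.IsIntegralElem, ← Polynomial.hom_eval₂, map_eq_zero_iff g hg]

/-- Noether normalization over the generic point of a domain `A`, inside a common extension `L` of
an `A`-algebra `R` and the fraction field `K` of `A`. -/
theorem exists_algebraicIndependent_isIntegralElem_mul {A R : Type*} (K L : Type*) [CommRing A]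
    [IsDomain A] [CommRing R] [Algebra A R] [Field K] [Algebra A K] [IsFractionRing A K] [Field L]
    [Algebra R L] [FaithfulSMul R L] [Algebra A L] [Algebra K L] [IsScalarTower A K L]
    [IsScalarTower A R L] (s : Finset R) :
    ∃ (r : ℕ) (y : Fin r → R), AlgebraicIndependent A y ∧ ∀ z ∈ s, ∃ a : A, a ≠ 0 ∧
      (aeval y : MvPolynomial (Fin r) A →ₐ[A] R).toRingHom.IsIntegralElem
        (algebraMap A R a * z) := by
  classical
  have hRL := FaithfulSMul.algebraMap_injective R L
  have hAK := IsFractionRing.injective A K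
  let E := Algebra.adjoin K (algebraMap R L '' s)
  have : Algebra.FiniteType K E := by
    rw [← Subalgebra.fg_iff_finiteType]
    exact ⟨s.image (algebraMap R L), by rw [Finset.coe_image]⟩
  obtain ⟨r, g, ginj, gint⟩ := exists_integral_inj_algHom_of_fg K E
  choose a ha w hw using fun i => exists_denominator (A := A) (g (X i)).2
  -- One common denominator `β` for all variables: rescaling every `X i` by `β` is an automorphism
  -- of `K[X]`, so it moves the normalization into `R` without losing injectivity or integrality.
  have hb : ∏ i, a i ≠ 0 := Finset.prod_ne_zero_iff.2 fun i _ => ha i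
  choose c hc using fun i => Finset.dvd_prod_of_mem a (Finset.mem_univ i)
  let β := algebraMap A K (∏ i, a i)
  have hβ : β ≠ 0 := (map_ne_zero_iff _ hAK).2 hb
  let y : Fin r → R := fun i => algebraMap A R (c i) * w i
  have hy : ∀ i, algebraMap R L (y i) = algebraMap K L β * g (X i) := fun i => by
    simp only [y, β, map_mul, hw, ← IsScalarTower.algebraMap_apply, hc i]
    ring
  let h : MvPolynomial (Fin r) K →ₐ[K] L := aeval fun i => algebraMap R L (y i)
  let sc : K → MvPolynomial (Fin r) K →ₐ[K] MvPolynomial (Fin r) K := fun q =>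
    aeval fun i => C q * X i
  have hsc : ∀ q q', q * q' = 1 → (sc q).comp (sc q') = AlgHom.id _ _ := fun q q' hq => by
    ext1 i
    simp only [sc, AlgHom.comp_apply, aeval_X, map_mul, AlgHom.id_apply, ← mul_assoc]
    simp [← C_mul, mul_comm q' q, hq]
  have h1 : h = (E.val.comp g).comp (sc β) := by
    ext1 i
    simp only [h, sc, aeval_X, hy, AlgHom.comp_apply, map_mul]
    congr 1
    rw [← algebraMap_eq, AlgHom.commutes, AlgHom.commutes]
  have h2 : E.val.comp g = h.comp (sc β⁻¹) := by
    rw [h1, AlgHom.comp_assoc, hsc _ _ (mul_inv_cancel₀ hβ), AlgHom.comp_id]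
  have hinj : Function.Injective h := by
    rw [h1]
    refine (Subtype.val_injective.comp ginj).comp (Function.LeftInverse.injective (g := sc β⁻¹) ?_)
    exact fun p => DFunLike.congr_fun (hsc _ _ (inv_mul_cancel₀ hβ)) p
  have hcomm : (algebraMap R L).comp (aeval y : MvPolynomial (Fin r) A →ₐ[A] R).toRingHom =
      h.toRingHom.comp (map (algebraMap A K)) := by
    ext i
    · simp [h, ← IsScalarTower.algebraMap_apply]
    · simp [h]
  refine ⟨r, y, ?_, fun z hz => ?_⟩
  · refine Function.Injective.of_comp (f := algebraMap R L) ?_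
    have := hinj.comp (map_injective (σ := Fin r) (algebraMap A K) hAK)
    intro p q hpq
    apply this
    have e := fun p => DFunLike.congr_fun hcomm p
    exact (e p).symm.trans (hpq.trans (e q))
  · have hzE : algebraMap R L z ∈ E := Algebra.subset_adjoin ⟨z, hz, rfl⟩
    have hint : h.toRingHom.IsIntegralElem (algebraMap R L z) := by
      refine RingHom.IsIntegralElem.of_comp (f := (sc β⁻¹).toRingHom) ?_
      have := (isIntegralElem_comp_iff_of_injective g.toRingHom E.val.toRingHom
        Subtype.val_injective ⟨_, hzE⟩).2 (gint _)
      have e : E.val.toRingHom.comp g.toRingHom = h.toRingHom.comp (sc β⁻¹).toRingHom :=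
        congrArg AlgHom.toRingHom h2
      rwa [e] at this
    -- `K[X]` is the localization of `A[X]` at the nonzero constants, so an integral equation over
    -- `K[X]` descends to `A[X]` after multiplying by a constant `a`.
    let : Algebra (MvPolynomial (Fin r) A) (MvPolynomial (Fin r) K) := algebraMvPolynomial
    let : Algebra (MvPolynomial (Fin r) K) L := h.toRingHom.toAlgebra
    let : Algebra (MvPolynomial (Fin r) A) L :=
      (h.toRingHom.comp (map (algebraMap A K))).toAlgebra
    have : IsScalarTower (MvPolynomial (Fin r) A) (MvPolynomial (Fin r) K) L :=
      .of_algebraMap_eq fun _ => rfl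
    obtain ⟨⟨_, a, ha, rfl⟩, hm⟩ := IsIntegral.exists_multiple_integral_of_isLocalization
      ((nonZeroDivisors A).map (C : A →+* MvPolynomial (Fin r) A))
      (Rₘ := MvPolynomial (Fin r) K) (algebraMap R L z) hint
    refine ⟨a, nonZeroDivisors.ne_zero ha, ?_⟩
    rw [← isIntegralElem_comp_iff_of_injective _ _ hRL, hcomm]
    convert! hm using 1
    rw [Submonoid.smul_def, Algebra.smul_def, map_mul, ← IsScalarTower.algebraMap_apply]
    congr 1
    rw [RingHom.algebraMap_toAlgebra]
    simp [IsScalarTower.algebraMap_apply A K L]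

/-- Generic Noether normalization: after inverting one element `f` of the domain `A`, the finitely
generated extension `R` is integral over a polynomial ring. -/
theorem exists_algebraicIndependent_isIntegralElem_pow_mul {A R : Type*} [CommRing A] [IsDomain A]
    [CommRing R] [IsDomain R] [Algebra A R] [FaithfulSMul A R] [Algebra.FiniteType A R] :
    ∃ (r : ℕ) (y : Fin r → R) (f : A), f ≠ 0 ∧ AlgebraicIndependent A y ∧ ∀ z : R, ∃ N : ℕ,
      (aeval y : MvPolynomial (Fin r) A →ₐ[A] R).toRingHom.IsIntegralElem
        (algebraMap A R f ^ N * z) := by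
  classical
  obtain ⟨s, hs⟩ := Algebra.FiniteType.out (R := A) (A := R)
  let := FractionRing.liftAlgebra A (FractionRing R)
  obtain ⟨r, y, hy, h⟩ := exists_algebraicIndependent_isIntegralElem_mul
    (A := A) (FractionRing A) (FractionRing R) s
  choose a ha hint using fun z : s => h z z.2
  have hC : ∀ b : A, (aeval y : MvPolynomial (Fin r) A →ₐ[A] R).toRingHom.IsIntegralElem
      (algebraMap A R b) := fun b => by
    simpa using (aeval y : MvPolynomial (Fin r) A →ₐ[A] R).toRingHom.isIntegralElem_map (x := C b)
  refine ⟨r, y, ∏ z, a z, Finset.prod_ne_zero_iff.2 fun z _ => ha z, hy, fun z => ?_⟩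
  have hz : z ∈ Algebra.adjoin A (s : Set R) := hs ▸ Algebra.mem_top
  induction hz using Algebra.adjoin_induction with
  | mem z hz =>
    obtain ⟨c, hc⟩ := Finset.dvd_prod_of_mem a (Finset.mem_univ ⟨z, hz⟩)
    refine ⟨1, ?_⟩
    rw [pow_one, hc, map_mul, mul_comm (algebraMap A R _), mul_assoc]
    exact (hC c).mul _ (hint ⟨z, hz⟩)
  | algebraMap b => exact ⟨0, by simpa using hC b⟩
  | add z w _ _ hz hw =>
    obtain ⟨N, hN⟩ := hz
    obtain ⟨M, hM⟩ := hw
    refine ⟨N + M, ?_⟩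
    have e : ∀ t : R, t ^ (N + M) * (z + w) = t ^ M * (t ^ N * z) + t ^ N * (t ^ M * w) :=
      fun t => by ring
    rw [e]
    simp only [← map_pow] at hN hM ⊢
    exact ((hC _).mul _ hN).add _ ((hC _).mul _ hM)
  | mul z w _ _ hz hw =>
    obtain ⟨N, hN⟩ := hz
    obtain ⟨M, hM⟩ := hw
    refine ⟨N + M, ?_⟩
    have e : ∀ t : R, t ^ (N + M) * (z * w) = (t ^ N * z) * (t ^ M * w) := fun t => by ring
    rw [e]
    exact hN.mul _ hM

theorem exists_algHom_comp_eq {k A B C : Type*} [CommRing k] [CommRing A] [CommRing B]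
    [CommRing C] [Algebra k A] [Algebra k B] [Algebra k C] {f : A →ₐ[k] B}
    (hf : Function.Surjective f) (g : A →ₐ[k] C)
    (h : ∀ a ∈ RingHom.ker f, g a = 0) : ∃ θ : B →ₐ[k] C, ∀ a, θ (f a) = g a := by
  refine ⟨(Ideal.Quotient.liftₐ _ g h).comp
    (Ideal.quotientKerAlgEquivOfSurjective hf).symm.toAlgHom, fun a => ?_⟩
  have : (Ideal.quotientKerAlgEquivOfSurjective hf).symm (f a) = Ideal.Quotient.mk _ a := by
    rw [AlgEquiv.symm_apply_eq]
    rfl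
  exact congrArg (Ideal.Quotient.liftₐ _ g h) this

/-! ### Fibers over the locus where `f` does not vanish -/

section Fiber

variable {k A R : Type*} [Field k] [CommRing A] [CommRing R] [Algebra k A] [Algebra k R]
  [Algebra A R] [IsScalarTower k A R] {r : ℕ} {y : Fin r → R} {f : A}

theorem algebraMap_sub_mem_map_ker (p : A →ₐ[k] k) (a : A) :
    algebraMap A R a - algebraMap k R (p a) ∈ (RingHom.ker p).map (algebraMap A R) := by
  rw [IsScalarTower.algebraMap_apply k A R, ← map_sub]
  refine Ideal.mem_map_of_mem _ ?_
  rw [RingHom.mem_ker, map_sub, AlgHom.commutes, Algebra.algebraMap_self_apply, sub_self]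

/-- The fiber of `R` over a point of `A` at which `f` does not vanish is integral over the
polynomial ring. -/
theorem isIntegral_aeval_fiber
    (hint : ∀ z : R, ∃ N : ℕ, (aeval y : MvPolynomial (Fin r) A →ₐ[A] R).toRingHom.IsIntegralElem
      (algebraMap A R f ^ N * z)) (p : A →ₐ[k] k) (hp : p f ≠ 0) :
    (aeval fun i => Ideal.Quotient.mk ((RingHom.ker p).map (algebraMap A R)) (y i) :
      MvPolynomial (Fin r) k →ₐ[k] _).toRingHom.IsIntegral := by
  set I := (RingHom.ker p).map (algebraMap A R)
  set φ := (aeval fun i => Ideal.Quotient.mk I (y i) : MvPolynomial (Fin r) k →ₐ[k] R ⧸ I)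
  have hmk : ∀ a : A, Ideal.Quotient.mk I (algebraMap A R a) = φ (C (p a)) := fun a => by
    rw [← algebraMap_eq, AlgHom.commutes]
    exact (Ideal.Quotient.mk_eq_mk_iff_sub_mem _ _).2 (algebraMap_sub_mem_map_ker p a)
  have hcomm : (Ideal.Quotient.mk I).comp
      (aeval y : MvPolynomial (Fin r) A →ₐ[A] R).toRingHom =
      φ.toRingHom.comp (map (p : A →+* k)) := by
    ext a
    · simpa using hmk a
    · simp [φ]
  intro z
  obtain ⟨z, rfl⟩ := Ideal.Quotient.mk_surjective z
  obtain ⟨N, P, hP, hPz⟩ := hint z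
  have h1 : (φ.toRingHom.comp (map (p : A →+* k))).IsIntegralElem
      (Ideal.Quotient.mk I (algebraMap A R f ^ N * z)) :=
    ⟨P, hP, by rw [← hcomm, ← Polynomial.hom_eval₂, hPz, map_zero]⟩
  have h2 := (φ.toRingHom.isIntegralElem_map (x := C ((p f)⁻¹ ^ N))).mul _ h1.of_comp
  convert! h2 using 1
  rw [map_mul, ← map_pow (algebraMap A R), hmk, map_pow p, ← mul_assoc]
  change _ = φ _ * φ _ * _
  rw [← map_mul, ← C_mul, ← mul_pow, inv_mul_cancel₀ hp, one_pow, C_1, map_one, one_mul]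

/-- A relation `P` on the fiber is refuted at a point `q` with `P(q) ≠ 0`: lying over gives a prime
above `(p, q)`, and the extended ideal of `p` lands in it up to powers of `f`. This would force
`p(f)^N P(q) = 0`. -/
theorem injective_aeval_fiber [Infinite k] (hy : AlgebraicIndependent A y)
    (hint : ∀ z : R, ∃ N : ℕ, (aeval y : MvPolynomial (Fin r) A →ₐ[A] R).toRingHom.IsIntegralElem
      (algebraMap A R f ^ N * z)) (p : A →ₐ[k] k) (hp : p f ≠ 0) :
    Function.Injective
      (aeval fun i => Ideal.Quotient.mk ((RingHom.ker p).map (algebraMap A R)) (y i) :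
        MvPolynomial (Fin r) k →ₐ[k] _) := by
  let φ := (aeval y : MvPolynomial (Fin r) A →ₐ[A] R)
  let : Algebra (MvPolynomial (Fin r) A) R := φ.toRingHom.toAlgebra
  rw [injective_iff_map_eq_zero]
  intro P hP
  by_contra hP0
  obtain ⟨q, hq⟩ : ∃ q : Fin r → k, eval q P ≠ 0 := by
    by_contra! hq
    exact hP0 (MvPolynomial.funext fun x => by simp [hq x])
  let ev : MvPolynomial (Fin r) A →+* k := eval₂Hom (p : A →+* k) q
  -- `R` is integral over `A[X]` only after inverting `f`; lying over is applied to the integral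
  -- closure, which contains `f^N z` for some `N`.
  let Cl := integralClosure (MvPolynomial (Fin r) A) R
  have : (RingHom.ker ev).IsPrime := RingHom.ker_isPrime ev
  obtain ⟨Q, -, hQ, hQev⟩ := Ideal.exists_ideal_over_prime_of_isIntegral (RingHom.ker ev)
    (⊥ : Ideal Cl) (by
      rw [← RingHom.ker_eq_comap_bot, (RingHom.injective_iff_ker_eq_bot _).1]
      · exact bot_le
      · exact fun a b hab => hy (congrArg Subtype.val hab))
  have hQmem : ∀ b : MvPolynomial (Fin r) A, algebraMap _ Cl b ∈ Q ↔ ev b = 0 := fun b => by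
    rw [← Ideal.mem_comap, hQev, RingHom.mem_ker]
  have hfC : ∀ N, algebraMap A R f ^ N = algebraMap (MvPolynomial (Fin r) A) R (C (f ^ N)) :=
    fun N => by
      change _ = φ _
      simp [φ]
  have key : ∀ x ∈ (RingHom.ker p).map (algebraMap A R),
      ∃ N, ∃ w ∈ Q, (w : R) = algebraMap A R f ^ N * x := by
    intro x hx
    induction hx using Submodule.span_induction with
    | mem x hx =>
      obtain ⟨a, ha, rfl⟩ := hx
      refine ⟨0, algebraMap (MvPolynomial (Fin r) A) Cl (C a),
        (hQmem _).2 (by simpa [ev] using ha), ?_⟩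
      change φ _ = _
      simp [φ]
    | zero => exact ⟨0, 0, Q.zero_mem, by simp⟩
    | add x x' _ _ h h' =>
      obtain ⟨N, w, hw, hwx⟩ := h
      obtain ⟨N', w', hw', hwx'⟩ := h'
      refine ⟨N + N', algebraMap (MvPolynomial (Fin r) A) Cl (C (f ^ N')) * w +
        algebraMap (MvPolynomial (Fin r) A) Cl (C (f ^ N)) * w',
        Q.add_mem (Q.mul_mem_left _ hw) (Q.mul_mem_left _ hw'), ?_⟩
      change algebraMap (MvPolynomial (Fin r) A) R _ * (w : R) + algebraMap _ R _ * (w' : R) = _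
      rw [← hfC, ← hfC, hwx, hwx']
      ring
    | smul z x _ h =>
      obtain ⟨N, w, hw, hwx⟩ := h
      obtain ⟨M, hM⟩ := hint z
      refine ⟨M + N, ⟨_, hM⟩ * w, Q.mul_mem_left _ hw, ?_⟩
      change (algebraMap A R f ^ M * z) * (w : R) = _
      rw [hwx, smul_eq_mul]
      ring
  have hPI : φ (map (algebraMap k A) P) ∈ (RingHom.ker p).map (algebraMap A R) := by
    rw [← Ideal.Quotient.eq_zero_iff_mem, ← hP]
    change ((Ideal.Quotient.mk _).comp (φ.toRingHom.comp (map (algebraMap k A)))) P =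
      (aeval _ : MvPolynomial (Fin r) k →ₐ[k] _).toRingHom P
    congr 1
    ext a
    · simp [φ, ← IsScalarTower.algebraMap_apply]
    · simp [φ]
  obtain ⟨N, w, hw, hwx⟩ := key _ hPI
  have hw' : w = algebraMap _ Cl (C (f ^ N) * map (algebraMap k A) P) := by
    apply Subtype.ext
    rw [hwx, hfC]
    exact (map_mul (algebraMap (MvPolynomial (Fin r) A) R) _ _).symm
  rw [hw', hQmem, map_mul] at hw
  have e1 : ev (C (f ^ N)) = p f ^ N := by simp [ev]
  have e2 : ev (map (algebraMap k A) P) = eval q P := by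
    have : (p : A →+* k).comp (algebraMap k A) = RingHom.id k := by ext; simp
    simp only [ev, coe_eval₂Hom, eval₂_map, this]
    rfl
  rw [e1, e2] at hw
  exact mul_ne_zero (pow_ne_zero _ hp) hq hw

/-- The fibers of `R` over the points of `A` at which `f` does not vanish have dimension `r`. -/
theorem ringKrullDim_fiber [Infinite k] (hy : AlgebraicIndependent A y)
    (hint : ∀ z : R, ∃ N : ℕ, (aeval y : MvPolynomial (Fin r) A →ₐ[A] R).toRingHom.IsIntegralElem
      (algebraMap A R f ^ N * z)) (p : A →ₐ[k] k) (hp : p f ≠ 0) :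
    ringKrullDim (R ⧸ (RingHom.ker p).map (algebraMap A R)) = r := by
  let φ := (aeval fun i => Ideal.Quotient.mk ((RingHom.ker p).map (algebraMap A R)) (y i) :
    MvPolynomial (Fin r) k →ₐ[k] _)
  let := φ.toRingHom.toAlgebra
  have : Algebra.IsIntegral (MvPolynomial (Fin r) k)
      (R ⧸ (RingHom.ker p).map (algebraMap A R)) := ⟨isIntegral_aeval_fiber hint p hp⟩
  rw [← ringKrullDim_eq_of_isIntegral_of_injective (R := MvPolynomial (Fin r) k)
    (injective_aeval_fiber hy hint p hp), MvPolynomial.ringKrullDim_of_isNoetherianRing]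
  simp

/-- Since `f^N z` is integral over `A[y]` and `f ≠ 0`, `y` is a transcendence basis of `R` over `A`;
transcendence degrees add in towers. -/
theorem finite_trdeg_add [IsDomain A] [IsDomain R] [FaithfulSMul k A] [FaithfulSMul A R]
    [Algebra.FiniteType k A] (hy : AlgebraicIndependent A y)
    (hint : ∀ z : R, ∃ N : ℕ, (aeval y : MvPolynomial (Fin r) A →ₐ[A] R).toRingHom.IsIntegralElem
      (algebraMap A R f ^ N * z)) (hf : f ≠ 0) :
    (Algebra.trdeg k A).toNat + r = (Algebra.trdeg k R).toNat := by
  have halg : Algebra.IsAlgebraic (Algebra.adjoin A (Set.range y)) R := by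
    refine ⟨fun z => ?_⟩
    obtain ⟨N, hN⟩ := hint z
    let ψ : MvPolynomial (Fin r) A →ₐ[A] Algebra.adjoin A (Set.range y) :=
      aeval fun i => ⟨y i, Algebra.subset_adjoin ⟨i, rfl⟩⟩
    have hψ : (aeval y : MvPolynomial (Fin r) A →ₐ[A] R) =
        (Algebra.adjoin A (Set.range y)).val.comp ψ := by
      ext i
      simp [ψ]
    have h1 : IsIntegral (Algebra.adjoin A (Set.range y)) (algebraMap A R f ^ N * z) := by
      rw [hψ] at hN
      exact hN.of_comp (f := ψ.toRingHom)
    have h2 : algebraMap A R f ^ N * z =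
        (algebraMap A (Algebra.adjoin A (Set.range y)) f ^ N) • z := by
      rw [Algebra.smul_def, map_pow, ← IsScalarTower.algebraMap_apply]
    rw [h2] at h1
    refine h1.isAlgebraic.of_smul (mem_nonZeroDivisors_of_ne_zero (pow_ne_zero _ ?_))
    exact (map_ne_zero_iff _ (FaithfulSMul.algebraMap_injective _ _)).2 hf
  have hr := (isTranscendenceBasis_iff_algebraicIndependent_isAlgebraic.2
    ⟨hy, halg⟩).lift_cardinalMk_eq_trdeg
  have hA := trdeg_lt_aleph0_of_finiteType (R := k) (S := A)
  have hAR := lift_trdeg_add_eq k A R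
  have hr' : (Algebra.trdeg A R).toNat = r := by simpa using congr(Cardinal.toNat $hr.symm)
  have hlt : Algebra.trdeg A R < Cardinal.aleph0 := by
    rw [← Cardinal.lift_lt_aleph0, ← hr]
    simp
  have := congrArg Cardinal.toNat hAR
  rw [Cardinal.toNat_lift_add_lift hA hlt, Cardinal.toNat_lift, hr'] at this
  exact this

end Fiber

end CommutativeAlgebra

/-! ### From `k`-points to prime spectra -/

section Points

variable {k F : Type*} [Field k] [IsAlgClosed k] [CommRing F] [Algebra k F] [Algebra.FiniteType k F]

/-- Zariski's lemma: the maximal ideals are the kernels of the `k`-points. -/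
theorem exists_algHom_ker_eq (m : Ideal F) (hm : m.IsMaximal) :
    ∃ φ : F →ₐ[k] k, RingHom.ker φ = m := by
  let := Ideal.Quotient.field m
  have : Module.Finite k (F ⧸ m) := finite_of_finite_type_of_isJacobsonRing k (F ⧸ m)
  let e : k ≃ₐ[k] F ⧸ m := AlgEquiv.ofBijective (Algebra.ofId k (F ⧸ m))
    IsAlgClosed.algebraMap_bijective_of_isIntegral
  refine ⟨e.symm.toAlgHom.comp (Ideal.Quotient.mkₐ k m), ?_⟩
  ext x
  rw [RingHom.mem_ker, AlgHom.comp_apply]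
  exact (map_eq_zero_iff e.symm e.symm.injective).trans Ideal.Quotient.eq_zero_iff_mem

/-- Nullstellensatz: in a reduced Jacobson ring the maximal ideals, all kernels of points, intersect
in zero. -/
theorem exists_algHom_ne_zero [IsReduced F] {z : F} (hz : z ≠ 0) : ∃ φ : F →ₐ[k] k, φ z ≠ 0 := by
  have hJ : IsJacobsonRing F := isJacobsonRing_of_finiteType (A := k)
  by_contra! h
  apply hz
  have hbot : (⊥ : Ideal F).jacobson = ⊥ := hJ.out Ideal.isRadical_bot
  rw [← Ideal.mem_bot, ← hbot, Ideal.jacobson, Ideal.mem_sInf]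
  rintro m ⟨-, hm⟩
  obtain ⟨φ, rfl⟩ := exists_algHom_ker_eq (k := k) m hm
  exact h φ

/-- The closed sets of a subspace whose points are very dense have the same dimension. -/
theorem topologicalKrullDim_eq_of_isInducing_of_closure {X Y : Type*} [TopologicalSpace X]
    [TopologicalSpace Y] {j : X → Y} (hj : Topology.IsInducing j)
    (hd : ∀ D : Set Y, IsClosed D → closure (j '' (j ⁻¹' D)) = D) :
    topologicalKrullDim X = topologicalKrullDim Y := by
  refine le_antisymm hj.topologicalKrullDim_le ?_
  have hirr : ∀ D : TopologicalSpace.IrreducibleCloseds Y, IsIrreducible (j ⁻¹' (D : Set Y)) := by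
    intro D
    have h1 : IsIrreducible (j '' (j ⁻¹' (D : Set Y))) := by
      rw [← isIrreducible_iff_closure, hd D D.isClosed]
      exact D.isIrreducible
    refine ⟨Set.image_nonempty.1 h1.1, ?_⟩
    intro U V hU hV hDU hDV
    obtain ⟨U, hU', rfl⟩ := hj.isOpen_iff.1 hU
    obtain ⟨V, hV', rfl⟩ := hj.isOpen_iff.1 hV
    obtain ⟨a, ha, haU⟩ := hDU
    obtain ⟨b, hb, hbV⟩ := hDV
    obtain ⟨_, ⟨c, hc, rfl⟩, hcU, hcV⟩ := h1.2 U V hU' hV' ⟨j a, ⟨a, ha, rfl⟩, haU⟩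
      ⟨j b, ⟨b, hb, rfl⟩, hbV⟩
    exact ⟨c, hc, hcU, hcV⟩
  refine Order.krullDim_le_of_strictMono
    (fun D => ⟨j ⁻¹' (D : Set Y), hirr D, D.isClosed.preimage hj.continuous⟩) fun D D' h => ?_
  refine lt_of_le_of_ne (fun x hx => h.le hx) fun heq => h.ne ?_
  have heq' : j ⁻¹' (D : Set Y) = j ⁻¹' (D' : Set Y) := congrArg SetLike.coe heq
  apply SetLike.coe_injective
  rw [← hd D D.isClosed, heq', hd D' D'.isClosed]

/-- The dimension of the set of `k`-points of an algebra of finite type, embedded in affine space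
as a locally closed subset by the functions `x`, is the Krull dimension of the algebra. -/
theorem zariskiDim_range_algHom {σ : Type*} (x : σ → F)
    (hx : ∀ z : F, ∃ u : F, IsUnit u ∧ ∃ P : MvPolynomial σ k, z = u * MvPolynomial.aeval x P) :
    zariskiDim (Set.range fun (φ : F →ₐ[k] k) s => φ (x s)) = ringKrullDim F := by
  let := zariskiTopology k σ
  set S := Set.range fun (φ : F →ₐ[k] k) s => φ (x s)
  choose φ hφ using fun a : S => a.2
  have haev : ∀ (ψ : F →ₐ[k] k) P, ψ (MvPolynomial.aeval x P) =
      MvPolynomial.eval (fun s => ψ (x s)) P := fun ψ P => by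
    rw [← AlgHom.comp_apply, MvPolynomial.comp_aeval]
    rfl
  have hker : ∀ (ψ : F →ₐ[k] k) u P, IsUnit u → (ψ (u * MvPolynomial.aeval x P) = 0 ↔
      MvPolynomial.eval (fun s => ψ (x s)) P = 0) := fun ψ u P hu => by
    rw [map_mul, haev, mul_eq_zero_iff_left (hu.map ψ).ne_zero]
  -- The units in `hx` do not affect vanishing, so Zariski closed sets on both sides match. The
  -- image contains all closed points, which are very dense; nilpotents in `F` do no harm.
  let j : S → PrimeSpectrum F := fun a => ⟨RingHom.ker (φ a), RingHom.ker_isPrime _⟩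
  have hj : Topology.IsInducing j := by
    refine ⟨TopologicalSpace.ext_isClosed fun C => ?_⟩
    rw [isClosed_induced_iff, isClosed_induced_iff]
    constructor
    · rintro ⟨D, hD, rfl⟩
      obtain ⟨T, rfl⟩ := (isClosed_zariski_iff D).1 hD
      refine ⟨PrimeSpectrum.zeroLocus (MvPolynomial.aeval x '' T),
        PrimeSpectrum.isClosed_zeroLocus _, ?_⟩
      ext a
      simp only [Set.mem_preimage, PrimeSpectrum.mem_zeroLocus, Set.image_subset_iff]
      refine forall₂_congr fun P _ => ?_
      change φ a _ = 0 ↔ _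
      rw [haev]
      exact (congrArg (fun b => MvPolynomial.eval b P = 0) (hφ a)).to_iff
    · rintro ⟨D, hD, rfl⟩
      obtain ⟨Z, rfl⟩ := (PrimeSpectrum.isClosed_iff_zeroLocus D).1 hD
      refine ⟨zeros {P | ∃ u, IsUnit u ∧ u * MvPolynomial.aeval x P ∈ Z},
        (isClosed_zariski_iff _).2 ⟨_, rfl⟩, ?_⟩
      ext a
      simp only [Set.mem_preimage, PrimeSpectrum.mem_zeroLocus]
      constructor
      · intro h z hz
        obtain ⟨u, hu, P, rfl⟩ := hx z
        refine (hker (φ a) u P hu).2 ?_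
        have := h P ⟨u, hu, hz⟩
        rwa [← hφ a] at this
      · rintro h P ⟨u, hu, hP⟩
        have := (hker (φ a) u P hu).1 (h hP)
        rwa [← hφ a]
  have hrange : closedPoints (PrimeSpectrum F) ⊆ Set.range j := by
    intro q hq
    obtain ⟨ψ, hψ⟩ := exists_algHom_ker_eq (k := k) q.asIdeal
      ((PrimeSpectrum.isClosed_singleton_iff_isMaximal q).1 hq)
    refine ⟨⟨_, ψ, rfl⟩, PrimeSpectrum.ext ?_⟩
    rw [← hψ]
    ext z
    obtain ⟨u, hu, P, rfl⟩ := hx z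
    change φ _ _ = 0 ↔ ψ _ = 0
    rw [hker _ u P hu, hker _ u P hu]
    exact (congrArg (fun b => MvPolynomial.eval b P = 0) (hφ ⟨_, ψ, rfl⟩)).to_iff
  have hJ : IsJacobsonRing F := isJacobsonRing_of_finiteType (A := k)
  have : JacobsonSpace (PrimeSpectrum F) := PrimeSpectrum.isJacobsonRing_iff_jacobsonSpace.1 hJ
  rw [← PrimeSpectrum.topologicalKrullDim_eq_ringKrullDim]
  refine topologicalKrullDim_eq_of_isInducing_of_closure hj fun D hD => ?_
  refine (closure_minimal (Set.image_preimage_subset _ _) hD).antisymm ?_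
  rw [← closure_inter_closedPoints hD]
  refine closure_mono ?_
  rintro q ⟨hqD, hq⟩
  obtain ⟨a, rfl⟩ := hrange hq
  exact ⟨a, by rwa [closure_inter_closedPoints hD], rfl⟩

end Points

/-! ### The generic matrix and coordinate rings of orbit closures -/

section GenericAction

variable (k : Type*) [Field k] (n : ℕ)

/-- The coordinate ring of the general linear group. -/
abbrev CoordGL : Type _ := Localization.Away (Matrix.mvPolynomialX (Fin n) (Fin n) k).det

instance : IsDomain (CoordGL k n) :=
  IsLocalization.isDomain_localization
    (powers_le_nonZeroDivisors_of_noZeroDivisors (Matrix.det_mvPolynomialX_ne_zero (Fin n) k))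

instance : Algebra.FiniteType k (CoordGL k n) :=
  have : Algebra.FiniteType (MvPolynomial (Fin n × Fin n) k) (CoordGL k n) :=
    IsLocalization.finiteType_of_monoid_fg
      (Submonoid.powers (Matrix.mvPolynomialX (Fin n) (Fin n) k).det) _
  .trans (S := MvPolynomial (Fin n × Fin n) k) inferInstance this

/-- The generic invertible matrix. -/
noncomputable def genericGL : GL (Fin n) (CoordGL k n) :=
  Matrix.GeneralLinearGroup.mk''
    ((algebraMap (MvPolynomial (Fin n × Fin n) k) (CoordGL k n)).mapMatrix
      (Matrix.mvPolynomialX (Fin n) (Fin n) k))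
    (by
      rw [← RingHom.map_det]
      exact IsLocalization.Away.algebraMap_isUnit _)

variable {k n}

theorem genericGL_apply (i j : Fin n) : (genericGL k n).1 i j =
    algebraMap (MvPolynomial (Fin n × Fin n) k) (CoordGL k n) (MvPolynomial.X (i, j)) := rfl

/-- The invertible matrix corresponding to a point of the coordinate ring. -/
noncomputable def pointGL (φ : CoordGL k n →ₐ[k] k) : GL (Fin n) k :=
  Matrix.GeneralLinearGroup.map (φ : CoordGL k n →+* k) (genericGL k n)

theorem pointGL_apply (φ : CoordGL k n →ₐ[k] k) (i j : Fin n) :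
    (pointGL φ).1 i j = φ ((genericGL k n).1 i j) := rfl

theorem pointGL_inv_apply (φ : CoordGL k n →ₐ[k] k) (i j : Fin n) :
    (pointGL φ)⁻¹.1 i j = φ ((genericGL k n)⁻¹.1 i j) := by
  rw [pointGL, ← map_inv]
  rfl

theorem pointGL_surjective :
    Function.Surjective (pointGL : (CoordGL k n →ₐ[k] k) → GL (Fin n) k) := by
  intro g
  let ev : MvPolynomial (Fin n × Fin n) k →ₐ[k] k := MvPolynomial.aeval fun p => g.1 p.1 p.2
  have hev : IsUnit (ev (Matrix.mvPolynomialX (Fin n) (Fin n) k).det) := by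
    have : ev.toRingHom.mapMatrix (Matrix.mvPolynomialX (Fin n) (Fin n) k) = g.1 := by
      ext i j
      simp [ev, Matrix.mvPolynomialX_apply]
    change IsUnit (ev.toRingHom _)
    rw [RingHom.map_det, this]
    exact (Matrix.isUnit_iff_isUnit_det _).1 g.isUnit
  refine ⟨IsLocalization.liftAlgHom 
    (M := Submonoid.powers (Matrix.mvPolynomialX (Fin n) (Fin n) k).det) (f := ev) ?_, ?_⟩
  · rintro ⟨_, N, rfl⟩
    rw [map_pow]
    exact hev.pow N
  · ext i j
    rw [pointGL_apply, genericGL_apply, IsLocalization.liftAlgHom_apply, IsLocalization.lift_eq]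
    simp [ev]

theorem act_apply (g : GL (Fin n) k) (c : StructConst k n) (i j l : Fin n) :
    act g c (i, j, l) =
      ∑ t, g.1 l t * ∑ a, ∑ b, g⁻¹.1 a i * g⁻¹.1 b j * c (a, b, t) := by
  simp only [act, Matrix.mulVec, dotProduct, mul_apply]
  simp [Pi.single_apply]

/-- The structure constants of the image of an algebra under the generic matrix. -/
noncomputable def genericAct (c : StructConst k n) : Fin n × Fin n × Fin n → CoordGL k n := fun p =>
  ∑ t, (genericGL k n).1 p.2.2 t * ∑ a, ∑ b, (genericGL k n)⁻¹.1 a p.1 *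
    (genericGL k n)⁻¹.1 b p.2.1 * algebraMap k _ (c (a, b, t))

theorem algHom_genericAct (φ : CoordGL k n →ₐ[k] k) (c : StructConst k n) :
    (fun p => φ (genericAct c p)) = act (pointGL φ) c := by
  ext ⟨i, j, l⟩
  rw [act_apply]
  simp only [genericAct, map_sum, map_mul, AlgHom.commutes, pointGL_apply, pointGL_inv_apply,
    Algebra.algebraMap_self_apply]

theorem algHom_aeval_genericAct (φ : CoordGL k n →ₐ[k] k) (c : StructConst k n)
    (Q : MvPolynomial (Fin n × Fin n × Fin n) k) :
    φ (MvPolynomial.aeval (genericAct c) Q) = MvPolynomial.eval (act (pointGL φ) c) Q := by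
  rw [← algHom_genericAct, ← AlgHom.comp_apply, MvPolynomial.comp_aeval]
  rfl

/-- The coordinate ring of the orbit closure, embedded into the coordinate ring of the group. -/
noncomputable abbrev orbitRing (c : StructConst k n) : Subalgebra k (CoordGL k n) :=
  (MvPolynomial.aeval (genericAct c) : MvPolynomial _ k →ₐ[k] CoordGL k n).range

/-- The quotient map from the polynomial ring to the coordinate ring of the orbit closure. -/
noncomputable abbrev orbitMk (c : StructConst k n) :
    MvPolynomial (Fin n × Fin n × Fin n) k →ₐ[k] orbitRing c :=
  (MvPolynomial.aeval (genericAct c)).rangeRestrict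

instance (c : StructConst k n) : Algebra.FiniteType k (orbitRing c) :=
  .of_surjective (orbitMk c) (AlgHom.rangeRestrict_surjective _)

theorem mem_autSet_iff (c : StructConst k n) (a : Fin n × Fin n → k) :
    a ∈ autSet c ↔ ∃ g : GL (Fin n) k, act g c = c ∧ a = fun p => g.1 p.1 p.2 := by
  refine exists_congr fun g => and_congr_left fun _ => ?_
  constructor
  · intro h
    ext ⟨i, j, l⟩
    rw [← mul_single_single (act g c), mul_act, h, ← mul_single_single c]
    simp only [Matrix.mulVec_mulVec, ← Units.val_mul, mul_inv_cancel, Units.val_one,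
      Matrix.one_mulVec]
  · intro h x y
    have := mul_act_glEquiv g c x y
    rw [h] at this
    exact this.symm

theorem isomorphic_of_act_eq {c₁ c₂ : StructConst k n} {g₁ g₂ : GL (Fin n) k}
    (h : act g₁ c₁ = act g₂ c₂) : Isomorphic c₁ c₂ := by
  have h' : act (g₂⁻¹ * g₁) c₁ = c₂ := by
    rw [act_mul, h, ← act_mul, inv_mul_cancel, act_one]
  exact ⟨glEquiv (g₂⁻¹ * g₁), fun x y => by rw [← mul_act_glEquiv, h']⟩

/-- The restriction of a point of the group to the orbit ring. -/
noncomputable abbrev orbitPoint (c : StructConst k n) (φ : CoordGL k n →ₐ[k] k) :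
    orbitRing c →ₐ[k] k :=
  φ.comp (orbitRing c).val

theorem orbitPoint_eq_iff (c : StructConst k n) (φ ψ : CoordGL k n →ₐ[k] k) :
    orbitPoint c φ = orbitPoint c ψ ↔ act (pointGL φ) c = act (pointGL ψ) c := by
  rw [← algHom_genericAct, ← algHom_genericAct]
  constructor
  · intro h
    ext p
    have := DFunLike.congr_fun h (orbitMk c (MvPolynomial.X p))
    simpa using this
  · intro h
    rw [← AlgHom.cancel_right (AlgHom.rangeRestrict_surjective (MvPolynomial.aeval (genericAct c)))]
    ext p
    simpa using congr_fun h p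

end GenericAction

/-! ### Orbit dimension and strict growth of the automorphism group -/

section OrbitDimension

variable {k : Type*} [Field k] [IsAlgClosed k] {n : ℕ}

/-- The automorphism group is the fiber of the orbit map through any of its points. -/
theorem dimAut_eq_ringKrullDim_fiber (c : StructConst k n) (φ₀ : CoordGL k n →ₐ[k] k) :
    dimAut c = ringKrullDim (CoordGL k n ⧸
      (RingHom.ker (orbitPoint c φ₀)).map (algebraMap (orbitRing c) (CoordGL k n))) := by
  set I := (RingHom.ker (orbitPoint c φ₀)).map (algebraMap (orbitRing c) (CoordGL k n))
  let π := Ideal.Quotient.mkₐ k I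
  -- The fiber is the coset `pointGL φ₀ · Aut`; translating the generic matrix by the inverse of
  -- `pointGL φ₀` makes its points exactly the automorphisms.
  let x : Fin n × Fin n → CoordGL k n ⧸ I := fun p =>
    π (∑ t, algebraMap k _ ((pointGL φ₀)⁻¹.1 p.1 t) * (genericGL k n).1 t p.2)
  have hpt : ∀ ψ : (CoordGL k n ⧸ I) →ₐ[k] k, (fun p => ψ (x p)) =
      fun p => ((pointGL φ₀)⁻¹ * pointGL (ψ.comp π)).1 p.1 p.2 := fun ψ => by
    ext p
    simp only [x, Units.val_mul, Matrix.mul_apply, map_sum, map_mul, AlgHom.commutes,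
      pointGL_apply, AlgHom.comp_apply, Algebra.algebraMap_self_apply]
  have hfib : ∀ φ : CoordGL k n →ₐ[k] k, (∀ z ∈ I, φ z = 0) ↔
      orbitPoint c φ = orbitPoint c φ₀ := fun φ => by
    constructor
    · intro h
      ext a
      have := h _ (algebraMap_sub_mem_map_ker (R := CoordGL k n) (orbitPoint c φ₀) a)
      rw [map_sub, AlgHom.commutes, sub_eq_zero] at this
      exact this
    · intro h z hz
      have hle : I ≤ RingHom.ker φ := Ideal.map_le_iff_le_comap.2 fun a ha => by
        rw [← h] at ha
        exact ha
      exact hle hz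
  have hset : autSet c = Set.range fun (ψ : (CoordGL k n ⧸ I) →ₐ[k] k) p => ψ (x p) := by
    ext a
    rw [mem_autSet_iff]
    constructor
    · rintro ⟨h, hc, rfl⟩
      obtain ⟨φ, hφ⟩ := pointGL_surjective (pointGL φ₀ * h)
      have hφI := (hfib φ).2 ((orbitPoint_eq_iff c φ φ₀).2 (by rw [hφ, act_mul, hc]))
      refine ⟨Ideal.Quotient.liftₐ I φ hφI, ?_⟩
      have : (Ideal.Quotient.liftₐ I φ hφI).comp π = φ := Ideal.Quotient.liftₐ_comp _ _ _
      dsimp only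
      rw [hpt, this, hφ, inv_mul_cancel_left]
    · rintro ⟨ψ, rfl⟩
      refine ⟨_, ?_, hpt ψ⟩
      have := (orbitPoint_eq_iff c _ _).1 ((hfib (ψ.comp π)).1 fun z hz => by
        rw [AlgHom.comp_apply, show π z = 0 from Ideal.Quotient.eq_zero_iff_mem.2 hz, map_zero])
      rw [act_mul, this, ← act_mul, inv_mul_cancel, act_one]
  rw [dimAut, hset]
  refine zariskiDim_range_algHom x fun z => ?_
  obtain ⟨w, rfl⟩ := Ideal.Quotient.mk_surjective z
  obtain ⟨⟨Q, s⟩, hQ⟩ := IsLocalization.surj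
    (Submonoid.powers (Matrix.mvPolynomialX (Fin n) (Fin n) k).det) w
  have hs := IsLocalization.map_units (CoordGL k n) s
  obtain ⟨u, hu⟩ := hs
  -- The unit is an inverse power of the determinant; substituting `pointGL φ₀ · X` in the numerator
  -- undoes the translation in `x`.
  refine ⟨π ↑u⁻¹, (Units.isUnit _).map π, MvPolynomial.bind₁ (fun p => ∑ t,
    MvPolynomial.C ((pointGL φ₀).1 p.1 t) * MvPolynomial.X (t, p.2)) Q, ?_⟩
  have hX : ∀ i j, MvPolynomial.aeval x (∑ t,
      MvPolynomial.C ((pointGL φ₀).1 i t) * MvPolynomial.X (t, j)) =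
      π ((genericGL k n).1 i j) := fun i j => by
    have hinv : ∀ s, ∑ t, (pointGL φ₀).1 i t * (pointGL φ₀)⁻¹.1 t s =
        (1 : Matrix (Fin n) (Fin n) k) i s := fun s => by
      rw [← Matrix.mul_apply, ← Units.val_mul, mul_inv_cancel, Units.val_one]
    simp only [map_sum, map_mul, MvPolynomial.aeval_X, x, ← MvPolynomial.algebraMap_eq,
      AlgHom.commutes, Finset.mul_sum, ← mul_assoc]
    rw [Finset.sum_comm]
    simp only [← Finset.sum_mul, ← map_mul (algebraMap k _), ← map_sum (algebraMap k _), hinv]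
    simp [Matrix.one_apply]
  have hQ' : MvPolynomial.aeval x (MvPolynomial.bind₁ (fun p => ∑ t,
      MvPolynomial.C ((pointGL φ₀).1 p.1 t) * MvPolynomial.X (t, p.2)) Q) =
      π (algebraMap _ _ Q) := by
    rw [MvPolynomial.aeval_bind₁]
    simp only [hX, genericGL_apply]
    have := MvPolynomial.comp_aeval_apply (R := k) (f := MvPolynomial.X)
      (π.comp (IsScalarTower.toAlgHom k (MvPolynomial (Fin n × Fin n) k) (CoordGL k n))) Q
    rw [MvPolynomial.aeval_X_left_apply] at this
    exact this.symm
  rw [hQ', ← map_mul, ← hQ, ← hu, mul_comm w, Units.inv_mul_cancel_left]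
  rfl

/-- The dimension of the automorphism group complements that of the orbit, and the orbit contains
a nonempty open subset of its closure. -/
theorem exists_dimAut_eq (c : StructConst k n) :
    ∃ (r : ℕ) (f : orbitRing c), f ≠ 0 ∧ dimAut c = r ∧
      (Algebra.trdeg k (orbitRing c)).toNat + r = (Algebra.trdeg k (CoordGL k n)).toNat ∧
      ∀ p : orbitRing c →ₐ[k] k, p f ≠ 0 → ∃ φ, orbitPoint c φ = p := by
  have : Algebra.FiniteType (orbitRing c) (CoordGL k n) :=
    .of_restrictScalars_finiteType k _ _
  have : FaithfulSMul k (orbitRing c) :=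
    (faithfulSMul_iff_algebraMap_injective _ _).2 (algebraMap k (orbitRing c)).injective
  obtain ⟨r, y, f, hf, hy, hint⟩ :=
    exists_algebraicIndependent_isIntegralElem_pow_mul (A := orbitRing c) (R := CoordGL k n)
  refine ⟨r, f, hf, ?_, finite_trdeg_add hy hint hf, fun p hp => ?_⟩
  · have hf' : (f : CoordGL k n) ≠ 0 := fun h => hf (Subtype.ext h)
    obtain ⟨φ₀, hφ₀⟩ := exists_algHom_ne_zero (k := k) hf'
    rw [dimAut_eq_ringKrullDim_fiber c φ₀]
    exact ringKrullDim_fiber hy hint (orbitPoint c φ₀) hφ₀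
  · set I := (RingHom.ker p).map (algebraMap (orbitRing c) (CoordGL k n))
    have hdim : ringKrullDim (CoordGL k n ⧸ I) = r := ringKrullDim_fiber hy hint p hp
    -- Dimension `r` is not `⊥`, so the fiber ring is nonzero and has a `k`-point.
    have : Nontrivial (CoordGL k n ⧸ I) := by
      rw [← not_subsingleton_iff_nontrivial]
      intro hsub
      rw [ringKrullDim_eq_bot_of_subsingleton] at hdim
      exact WithBot.bot_ne_coe hdim
    obtain ⟨m, hm⟩ := Ideal.exists_maximal (CoordGL k n ⧸ I)
    obtain ⟨ψ, -⟩ := exists_algHom_ker_eq (k := k) m hm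
    refine ⟨ψ.comp (Ideal.Quotient.mkₐ k I), ?_⟩
    ext a
    have := algebraMap_sub_mem_map_ker (R := CoordGL k n) p a
    rw [← Ideal.Quotient.eq_zero_iff_mem, ← Ideal.Quotient.mkₐ_eq_mk k] at this
    have h0 := congrArg ψ this
    rw [map_sub, map_sub, AlgHom.commutes, AlgHom.commutes, map_zero, sub_eq_zero] at h0
    exact h0

/-- Equations of the orbit of `c₁` hold on that of `c₂`; a function on GL_n vanishing at all
`k`-points is zero. -/
theorem Deforms.exists_orbitRing_surjection {c₁ c₂ : StructConst k n} (h : Deforms c₁ c₂) :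
    ∃ θ : orbitRing c₁ →ₐ[k] orbitRing c₂, ∀ Q, θ (orbitMk c₁ Q) = orbitMk c₂ Q := by
  have hker : ∀ Q ∈ RingHom.ker (orbitMk c₁), orbitMk c₂ Q = 0 := by
    intro Q hQ
    apply Subtype.ext
    by_contra hne
    obtain ⟨φ, hφ⟩ := exists_algHom_ne_zero (k := k) hne
    apply hφ
    change φ (MvPolynomial.aeval (genericAct c₂) Q) = 0
    rw [algHom_aeval_genericAct]
    refine eval_eq_zero_of_mem_closure (h ⟨_, rfl⟩) Q ?_
    rintro _ ⟨g, rfl⟩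
    obtain ⟨ψ, rfl⟩ := pointGL_surjective g
    change MvPolynomial.eval (act (pointGL ψ) c₁) Q = 0
    rw [← algHom_aeval_genericAct, show MvPolynomial.aeval (genericAct c₁) Q = 0 from
      congrArg Subtype.val hQ, map_zero]
  exact exists_algHom_comp_eq (AlgHom.rangeRestrict_surjective _) _ hker

/-- A proper deformation strictly increases the dimension of the automorphism group. -/
theorem Deforms.dimAut_lt {c₁ c₂ : StructConst k n} (h : Deforms c₁ c₂)
    (hiso : ¬ Isomorphic c₁ c₂) : dimAut c₁ < dimAut c₂ := by
  obtain ⟨r₁, f, hf, hdim₁, htr₁, hpt⟩ := exists_dimAut_eq c₁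
  obtain ⟨r₂, -, -, hdim₂, htr₂, -⟩ := exists_dimAut_eq c₂
  obtain ⟨θ, hθ⟩ := h.exists_orbitRing_surjection
  have hinj : ¬ Function.Injective θ := by
    intro hinj
    have hne : (θ f : CoordGL k n) ≠ 0 := fun h0 =>
      hf ((map_eq_zero_iff θ hinj).1 (Subtype.ext h0))
    obtain ⟨φ, hφ⟩ := exists_algHom_ne_zero (k := k) hne
    obtain ⟨ψ, hψ⟩ := hpt ((orbitPoint c₂ φ).comp θ) hφ
    apply hiso
    refine isomorphic_of_act_eq (g₁ := pointGL ψ) (g₂ := pointGL φ) ?_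
    rw [← algHom_genericAct, ← algHom_genericAct]
    ext p
    have := DFunLike.congr_fun hψ (orbitMk c₁ (MvPolynomial.X p))
    rw [AlgHom.comp_apply _ θ, hθ] at this
    simpa using this
  have hsurj : Function.Surjective θ := by
    intro a
    obtain ⟨Q, rfl⟩ := AlgHom.rangeRestrict_surjective (MvPolynomial.aeval (genericAct c₂)) a
    exact ⟨_, hθ Q⟩
  have hlt := trdeg_lt_trdeg_of_surjective θ hsurj hinj
  rw [hdim₁, hdim₂]
  have : r₁ < r₂ := by omega
  exact_mod_cast this

end OrbitDimension

end JordanDeformation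

theorem mainTheorem3 {k : Type*} [Field k] [IsAlgClosed k]
    (h2 : ringChar k ≠ 2) (h3 : ringChar k ≠ 3) (n : ℕ)
    (J₁ J₂ : JordanDeformation.StructConst k n)
    (hJ₁ : J₁ ∈ JordanDeformation.Jor k n) (hJ₂ : J₂ ∈ JordanDeformation.Jor k n)
    (h : JordanDeformation.Deforms J₁ J₂) :
    (¬ JordanDeformation.Isomorphic J₁ J₂ →
      JordanDeformation.dimAut J₁ < JordanDeformation.dimAut J₂) ∧
    Module.finrank k (JordanDeformation.ann J₁) ≤ Module.finrank k (JordanDeformation.ann J₂) ∧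
    (∀ m : ℕ, 1 ≤ m → Module.finrank k (JordanDeformation.power J₂ m) ≤
      Module.finrank k (JordanDeformation.power J₁ m)) ∧
    Module.finrank k (JordanDeformation.assocCenter J₁) ≤
      Module.finrank k (JordanDeformation.assocCenter J₂) :=
  ⟨h.dimAut_lt, h.finrank_ann_le, fun m _ => h.finrank_power_le m, h.finrank_assocCenter_le⟩
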